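/- Let $b,c\in C[0,1]$ and $\lambda,a_1,a_2,a_3,a_4\in C([0,1]^2)$ be non-negative, let $\phi\in C[0,1]$ with $0\le\phi\le 1$, and let $T>0$. Let $\rho:[0,\infty)\to C[0,1]$ be the solution, with respect to the norm $\|\cdot\|_\infty$, of $\rho(0,\cdot)=\phi$ and \begin{align*} \tfrac{d}{dt}\rho(t,u)={}&b(u)(c(u)-1)\rho(t,u)+\rho(t,u)\int_0^1\lambda(v,u)(a_4(v,u)-1)\,dv+\rho(t,u)\int_0^1\lambda(u,v)(a_1(u,v)-1)\,dv\\ &+\int_0^1\lambda(u,v)a_2(u,v)\rho(t,v)\,dv+\int_0^1\lambda(v,u)a_3(v,u)\rho(t,v)\,dv . \end{align*} For $f\in C[0,1]$ put \begin{align*} P_2f(u)={}&(c(u)^2-1)b(u)f(u)+f(u)\int_0^1\lambda(u,v)(a_1(u,v)^2-1)\,dv+\int_0^1\lambda(v,u)a_2(v,u)^2f(v)\,dv\\ &+\int_0^1\lambda(u,v)a_3(u,v)^2f(v)\,dv+f(u)\int_0^1\lambda(v,u)(a_4(v,u)^2-1)\,dv,\\ l_{1,t}(f)={}&2\int_0^1\!\!\int_0^1\rho(t,u)\rho(t,v)a_1(u,v)a_2(u,v)\lambda(u,v)f(u)\,du\,dv\\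 &+2\int_0^1\!\!\int_0^1\lambda(v,u)a_3(v,u)a_4(v,u)\rho(t,u)\rho(t,v)f(u)\,du\,dv . \end{align*} Let $(\theta_t)_{0\le t\le T}$ be the solution, in the dual $(C[0,1])'$ with its norm, of $\frac{d}{dt}\theta_t=P_2^*\theta_t+l_{1,t}$ for $0\le t\le T$, $\theta_0(du)=\phi(u)\,du$, where $(P_2^*\nu)(f)=\nu(P_2f)$, and let $\vartheta\in C([0,T]\times[0,1])$ be its density: $\theta_t(du)=\vartheta(t,u)\,du$ for $0\le t\le T$. Define \begin{align*} K_1(s,u)={}&\vartheta(s,u)b(u)(c(u)-1)^2+\vartheta(s,u)\int_0^1\lambda(u,v)(a_1(u,v)-1)^2dv+\int_0^1\vartheta(s,v)\lambda(u,v)a_2(u,v)^2dv\\ &+\int_0^1\lambda(v,u)a_3(v,u)^2\vartheta(s,v)\,dv+\vartheta(s,u)\int_0^1\lambda(v,u)(a_4(v,u)-1)^2dv\\ &+2\rho(s,u)\int_0^1\lambda(u,v)(a_1(u,v)-1)a_2(u,v)\rho(s,v)\,dv\\ &+2\rho(s,u)\int_0^1\lambda(v,u)a_3(v,u)(a_4(v,u)-1)\rho(s,v)\,dv,\\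 K_2(s,u,v)={}&2\lambda(u,v)(a_1(u,v)-1)a_3(u,v)\vartheta(s,u)+2\lambda(u,v)a_2(u,v)(a_4(u,v)-1)\vartheta(s,v)\\ &+2\lambda(u,v)(a_1(u,v)-1)(a_4(u,v)-1)\rho(s,u)\rho(s,v)+2\lambda(u,v)a_2(u,v)a_3(u,v)\rho(s,u)\rho(s,v), \end{align*} and, for $f,g\in C[0,1]$ and $0\le s\le T$, \[ [f,f]_s=\int_0^1K_1(s,u)f(u)^2\,du+\int_0^1\!\!\int_0^1K_2(s,u,v)f(u)f(v)\,du\,dv,\qquad [f,g]_s=\frac{[f+g,f+g]_s-[f-g,f-g]_s}{4} \] (for $g=f$ the two definitions agree). Then such $\rho,\theta,\vartheta$ exist, and for any such $\rho,\theta,\vartheta$ and every $0\le s\le T$, $[\cdot,\cdot]_s$ is a non-negative definite symmetric bilinear form on $C[0,1]$: for all $f_1,f_2,g\in C[0,1]$ and $c_1,c_2\in\mathbb R$, \[ [f_1,f_1]_s\ge 0,\qquad [f_1,f_2]_s=[f_2,f_1]_s,\qquad [c_1f_1+c_2f_2,g]_s=c_1[f_1,g]_s+c_2[f_2,g]_s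 . \] -/

import Mathlib

open MeasureTheory unitInterval

noncomputable section

/-- The coefficients of the `N`-urn linear system: the rate functions `b`, `lam`, the
multiplicative coefficients `c`, `a1`, `a2`, `a3`, `a4`, and the initial profile `phi`,
all continuous on `[0,1]` or `[0,1]²`. -/
structure UrnSystem where
  b : C(I, ℝ)
  c : C(I, ℝ)
  lam : C(I × I, ℝ)
  a1 : C(I × I, ℝ)
  a2 : C(I × I, ℝ)
  a3 : C(I × I, ℝ)
  a4 : C(I × I, ℝ)
  phi : C(I, ℝ)

namespace UrnSystem

/-- The standing assumptions on the coefficients: all rates and coefficients are non-negative and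
the initial profile takes its values (probabilities) in `[0,1]`. -/
structure Admissible (S : UrnSystem) : Prop where
  b_nonneg : ∀ u, 0 ≤ S.b u
  c_nonneg : ∀ u, 0 ≤ S.c u
  lam_nonneg : ∀ p, 0 ≤ S.lam p
  a1_nonneg : ∀ p, 0 ≤ S.a1 p
  a2_nonneg : ∀ p, 0 ≤ S.a2 p
  a3_nonneg : ∀ p, 0 ≤ S.a3 p
  a4_nonneg : ∀ p, 0 ≤ S.a4 p
  phi_mem : ∀ u, 0 ≤ S.phi u ∧ S.phi u ≤ 1

/-- A continuous function on `[0,1]` (a compact space of total mass one) is integrable. -/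
theorem integrable_of_continuous {g : I → ℝ} (hg : Continuous g) : Integrable g :=
  integrableOn_univ.mp (hg.continuousOn.integrableOn_compact isCompact_univ)

/-- The integral operator `f ↦ (u ↦ ∫ k(u,v) f(v) dv)` on `C[0,1]`. -/
def kernelOp (k : C(I × I, ℝ)) : C(I, ℝ) →L[ℝ] C(I, ℝ) :=
  LinearMap.mkContinuous
    { toFun := fun f =>
        ⟨fun u => ∫ v : I, k (u, v) * f v, by
          have h : Continuous (Function.uncurry fun u v : I => k (u, v) * f v) := by
            simp only [Function.uncurry_def]
            fun_prop
          simpa using continuous_parametric_integral_of_continuous (μ := (volume : Measure I))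
            h isCompact_univ⟩
      map_add' := fun f g => by
        ext u
        simp only [ContinuousMap.coe_mk, ContinuousMap.add_apply, mul_add]
        exact integral_add (integrable_of_continuous (by fun_prop))
          (integrable_of_continuous (by fun_prop))
      map_smul' := fun r f => by
        ext u
        simp only [ContinuousMap.coe_mk, ContinuousMap.smul_apply, smul_eq_mul, RingHom.id_apply,
          ← integral_const_mul]
        exact integral_congr_ae (Filter.Eventually.of_forall fun v => by ring) }
    ‖k‖ (fun f => by
      rw [ContinuousMap.norm_le _ (by positivity)]
      intro u
      have h := norm_integral_le_of_norm_le_const (μ := (volume : Measure I))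
        (f := fun v : I => k (u, v) * f v) (C := ‖k‖ * ‖f‖)
        (Filter.Eventually.of_forall fun v => by
          rw [norm_mul]
          exact mul_le_mul (k.norm_coe_le_norm _) (f.norm_coe_le_norm _) (norm_nonneg _)
            (norm_nonneg _))
      simpa using h)

@[simp] theorem kernelOp_apply (k : C(I × I, ℝ)) (f : C(I, ℝ)) (u : I) :
    kernelOp k f u = ∫ v : I, k (u, v) * f v := rfl

/-- The function `u ↦ ∫ k(u,v) dv`. -/
def rowIntegral (k : C(I × I, ℝ)) : C(I, ℝ) := kernelOp k 1

@[simp] theorem rowIntegral_apply (k : C(I × I, ℝ)) (u : I) :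
    rowIntegral k u = ∫ v : I, k (u, v) := by
  simp [rowIntegral]

/-- The transposed kernel `(u,v) ↦ k(v,u)`. -/
def transpose (k : C(I × I, ℝ)) : C(I × I, ℝ) := k.comp ⟨Prod.swap, continuous_swap⟩

@[simp] theorem transpose_apply (k : C(I × I, ℝ)) (u v : I) :
    transpose k (u, v) = k (v, u) := rfl

/-- Multiplication by `g` as an operator on `C[0,1]`. -/
def mulOp (g : C(I, ℝ)) : C(I, ℝ) →L[ℝ] C(I, ℝ) := ContinuousLinearMap.mul ℝ C(I, ℝ) g

@[simp] theorem mulOp_apply (g f : C(I, ℝ)) (u : I) : mulOp g f u = g u * f u := rfl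

/-- The measure `g(u) du`, as an element of the dual of `C[0,1]`. -/
def densityFunctional (g : C(I, ℝ)) : StrongDual ℝ C(I, ℝ) :=
  LinearMap.mkContinuous
    { toFun := fun f => ∫ u : I, g u * f u
      map_add' := fun f h => by
        simp only [ContinuousMap.add_apply, mul_add]
        exact integral_add (integrable_of_continuous (by fun_prop))
          (integrable_of_continuous (by fun_prop))
      map_smul' := fun r f => by
        simp only [ContinuousMap.smul_apply, smul_eq_mul, RingHom.id_apply,
          ← integral_const_mul]
        exact integral_congr_ae (Filter.Eventually.of_forall fun v => by ring) }
    ‖g‖ (fun f => by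
      have h := norm_integral_le_of_norm_le_const (μ := (volume : Measure I))
        (f := fun v : I => g v * f v) (C := ‖g‖ * ‖f‖)
        (Filter.Eventually.of_forall fun v => by
          rw [norm_mul]
          exact mul_le_mul (g.norm_coe_le_norm _) (f.norm_coe_le_norm _) (norm_nonneg _)
            (norm_nonneg _))
      simpa using h)

@[simp] theorem densityFunctional_apply (g f : C(I, ℝ)) :
    densityFunctional g f = ∫ u : I, g u * f u := rfl

variable (S : UrnSystem)

/-- The right-hand side of the equation of the hydrodynamic density; see `hydroOp_apply`. -/
def hydroOp : C(I, ℝ) →L[ℝ] C(I, ℝ) :=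
  mulOp (S.b * (S.c - 1))
    + mulOp (rowIntegral (transpose (S.lam * (S.a4 - 1))))
    + mulOp (rowIntegral (S.lam * (S.a1 - 1)))
    + kernelOp (S.lam * S.a2)
    + kernelOp (transpose (S.lam * S.a3))

theorem hydroOp_apply (r : C(I, ℝ)) (u : I) :
    S.hydroOp r u =
      S.b u * (S.c u - 1) * r u
        + r u * (∫ v : I, S.lam (v, u) * (S.a4 (v, u) - 1))
        + r u * (∫ v : I, S.lam (u, v) * (S.a1 (u, v) - 1))
        + (∫ v : I, S.lam (u, v) * S.a2 (u, v) * r v)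
        + ∫ v : I, S.lam (v, u) * S.a3 (v, u) * r v := by
  simp [hydroOp, mul_comm (r u)]

/-- `ρ` solves the `C[0,1]`-valued equation `dρ/dt = hydroOp ρ`, `ρ(0) = φ`, for `t ≥ 0`, the
derivative being taken in the supremum norm (one-sided at `t = 0`). -/
def IsHydrodynamicDensity (ρ : ℝ → C(I, ℝ)) : Prop :=
  ρ 0 = S.phi ∧
    ∀ t : ℝ, 0 ≤ t → HasDerivWithinAt ρ (S.hydroOp (ρ t)) (Set.Ici 0) t

/-- `P₃ f(u) = (c(u)² - 1) b(u) f(u)`. -/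
def P3 : C(I, ℝ) →L[ℝ] C(I, ℝ) := mulOp ((S.c ^ 2 - 1) * S.b)

/-- `P₄ f(u) = f(u) ∫ λ(u,v) (a₁(u,v)² - 1) dv`. -/
def P4 : C(I, ℝ) →L[ℝ] C(I, ℝ) := mulOp (rowIntegral (S.lam * (S.a1 ^ 2 - 1)))

/-- `P₅ f(u) = ∫ λ(v,u) a₂(v,u)² f(v) dv`. -/
def P5 : C(I, ℝ) →L[ℝ] C(I, ℝ) := kernelOp (transpose (S.lam * S.a2 ^ 2))

/-- `P₆ f(u) = ∫ λ(u,v) a₃(u,v)² f(v) dv`. -/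
def P6 : C(I, ℝ) →L[ℝ] C(I, ℝ) := kernelOp (S.lam * S.a3 ^ 2)

/-- `P₇ f(u) = f(u) ∫ λ(v,u) (a₄(v,u)² - 1) dv`. -/
def P7 : C(I, ℝ) →L[ℝ] C(I, ℝ) := mulOp (rowIntegral (transpose (S.lam * (S.a4 ^ 2 - 1))))

/-- `P₂ = P₃ + P₄ + P₅ + P₆ + P₇`. -/
def P2 : C(I, ℝ) →L[ℝ] C(I, ℝ) := S.P3 + S.P4 + S.P5 + S.P6 + S.P7

theorem P2_apply (f : C(I, ℝ)) (u : I) :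
    S.P2 f u =
      (S.c u ^ 2 - 1) * S.b u * f u
        + f u * (∫ v : I, S.lam (u, v) * (S.a1 (u, v) ^ 2 - 1))
        + (∫ v : I, S.lam (v, u) * S.a2 (v, u) ^ 2 * f v)
        + (∫ v : I, S.lam (u, v) * S.a3 (u, v) ^ 2 * f v)
        + f u * ∫ v : I, S.lam (v, u) * (S.a4 (v, u) ^ 2 - 1) := by
  simp [P2, P3, P4, P5, P6, P7, mul_comm (f u)]

/-- The source functional `l₁`, for a given density `r = ρ(t,·)`; see `l1_apply`. -/
def l1 (r : C(I, ℝ)) : StrongDual ℝ C(I, ℝ) :=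
  (2 : ℝ) • densityFunctional (r * kernelOp (S.lam * S.a1 * S.a2) r)
    + (2 : ℝ) • densityFunctional (r * kernelOp (transpose (S.lam * S.a3 * S.a4)) r)

theorem l1_apply (r f : C(I, ℝ)) :
    S.l1 r f =
      2 * (∫ u : I, ∫ v : I, r u * r v * S.a1 (u, v) * S.a2 (u, v) * S.lam (u, v) * f u)
        + 2 * ∫ u : I, ∫ v : I,
            S.lam (v, u) * S.a3 (v, u) * S.a4 (v, u) * r u * r v * f u := by
  simp only [l1, add_apply, smul_apply,
    densityFunctional_apply, ContinuousMap.mul_apply, kernelOp_apply, transpose_apply, smul_eq_mul]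
  congr 2
  · refine integral_congr_ae (Filter.Eventually.of_forall fun u => ?_)
    simp only [← integral_const_mul, ← integral_mul_const]
    exact integral_congr_ae (Filter.Eventually.of_forall fun v => by ring)
  · refine integral_congr_ae (Filter.Eventually.of_forall fun u => ?_)
    simp only [← integral_const_mul, ← integral_mul_const]
    exact integral_congr_ae (Filter.Eventually.of_forall fun v => by ring)

/-- `θ` solves the equation `dθ_t/dt = P₂* θ_t + l_{1,t}`, `θ_0(du) = φ(u) du`, on `[0,T]` in the
dual of `C[0,1]` with its norm (derivatives are one-sided at the endpoints). Here
`(P₂* ν)(f) = ν(P₂ f)`. -/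
def IsSecondMomentSolution (T : ℝ) (ρ : ℝ → C(I, ℝ)) (θ : ℝ → StrongDual ℝ C(I, ℝ)) : Prop :=
  θ 0 = densityFunctional S.phi ∧
    ∀ t ∈ Set.Icc (0 : ℝ) T,
      HasDerivWithinAt θ ((θ t).comp S.P2 + S.l1 (ρ t)) (Set.Icc 0 T) t

/-- `θ_t(du) = ϑ(t,u) du` for all `t ∈ [0,T]`, with `ϑ ∈ C([0,T] × [0,1])`. -/
def IsDensityOf {T : ℝ} (ϑ : C(Set.Icc (0 : ℝ) T × I, ℝ)) (θ : ℝ → StrongDual ℝ C(I, ℝ)) : Prop :=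
  ∀ (t : Set.Icc (0 : ℝ) T) (f : C(I, ℝ)), θ t f = ∫ u : I, ϑ (t, u) * f u

section form

variable {T : ℝ} (ρ : ℝ → C(I, ℝ)) (ϑ : C(Set.Icc (0 : ℝ) T × I, ℝ)) (s : Set.Icc (0 : ℝ) T)

/-- The function `K₁(s,u)`. -/
def K1 (u : I) : ℝ :=
  ϑ (s, u) * S.b u * (S.c u - 1) ^ 2
    + ϑ (s, u) * (∫ v : I, S.lam (u, v) * (S.a1 (u, v) - 1) ^ 2)
    + (∫ v : I, ϑ (s, v) * S.lam (u, v) * S.a2 (u, v) ^ 2)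
    + (∫ v : I, S.lam (v, u) * S.a3 (v, u) ^ 2 * ϑ (s, v))
    + (∫ v : I, S.lam (v, u) * (S.a4 (v, u) - 1) ^ 2) * ϑ (s, u)
    + 2 * (∫ v : I, S.lam (u, v) * (S.a1 (u, v) - 1) * S.a2 (u, v) * ρ s v) * ρ s u
    + 2 * (∫ v : I, S.lam (v, u) * S.a3 (v, u) * (S.a4 (v, u) - 1) * ρ s v) * ρ s u

/-- The function `K₂(s,u,v)`. -/
def K2 (u v : I) : ℝ :=
  2 * S.lam (u, v) * (S.a1 (u, v) - 1) * S.a3 (u, v) * ϑ (s, u)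
    + 2 * S.lam (u, v) * S.a2 (u, v) * (S.a4 (u, v) - 1) * ϑ (s, v)
    + 2 * S.lam (u, v) * (S.a1 (u, v) - 1) * (S.a4 (u, v) - 1) * ρ s u * ρ s v
    + 2 * S.lam (u, v) * S.a2 (u, v) * S.a3 (u, v) * ρ s u * ρ s v

/-- The quadratic form `f ↦ [f,f]_s`. -/
def quadForm (f : C(I, ℝ)) : ℝ :=
  (∫ u : I, S.K1 ρ ϑ s u * f u ^ 2)
    + ∫ u : I, ∫ v : I, S.K2 ρ ϑ s u v * f u * f v

/-- The polarized form `[f,g]_s`. -/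
def bracket (f g : C(I, ℝ)) : ℝ :=
  (S.quadForm ρ ϑ s (f + g) - S.quadForm ρ ϑ s (f - g)) / 4

end form

end UrnSystem

end

/-! Everything rests on the pointwise inequality ρ² ≤ ϑ. Put A = (a₁-1)f(u) + a₃f(v) and B = a₂f(u)
+ (a₄-1)f(v), coefficients taken at (u,v). Collecting terms (`noiseForm_eq`), [f,f] is ∫ϑb(c-1)²f²
plus the double integral of λ(A²ϑ(u) + B²ϑ(v) + 2ABρ(u)ρ(v)). If ρ² ≤ ϑ, the bracket is at least
(Aρ(u) + Bρ(v))² ≥ 0.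

To prove ρ² ≤ ϑ, the dual equation is replaced by a predual one for densities in C[0,1]. Its
solution g minus ρ² satisfies w' = Pw + h, where P is `predualP2` and h is a sum of squares with
non-negative weights (`defect_eq`). The initial value φ - φ² is non-negative, and P generates a
positivity preserving semigroup, so w ≥ 0 by `mem_cone_of_hasDerivWithinAt`. Uniqueness in the dual,
and of continuous densities, gives ϑ = g. The same g proves existence. -/

/-! ### Linear equations with bounded generator and cone preserving semigroups. -/

section LinearODE

variable {E : Type*} [NormedAddCommGroup E] [NormedSpace ℝ E]

/-- Uniqueness for an inhomogeneous linear equation with bounded generator. -/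
theorem eqOn_of_hasDerivWithinAt_linear (A : E →L[ℝ] E) {T : ℝ} {L x y : ℝ → E}
    (hx : ∀ t ∈ Set.Icc 0 T, HasDerivWithinAt x (A (x t) + L t) (Set.Icc 0 T) t)
    (hy : ∀ t ∈ Set.Icc 0 T, HasDerivWithinAt y (A (y t) + L t) (Set.Icc 0 T) t)
    (h0 : x 0 = y 0) : Set.EqOn x y (Set.Icc 0 T) := by
  have hIci : ∀ {z : ℝ → E} {z' : E} {t : ℝ}, t ∈ Set.Ico 0 T →
      HasDerivWithinAt z z' (Set.Icc 0 T) t → HasDerivWithinAt z z' (Set.Ici t) t :=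
    fun ht h => h.mono_of_mem_nhdsWithin
      (Filter.mem_of_superset (Icc_mem_nhdsGE ht.2) (Set.Icc_subset_Icc_left ht.1))
  refine ODE_solution_unique_of_mem_Icc_right (v := fun t z => A z + L t) (s := fun _ => Set.univ)
    (K := ‖A‖₊) (fun t _ => ?_) (fun t ht => (hx t ht).continuousWithinAt)
    (fun t ht => hIci ht (hx t (Set.Ico_subset_Icc_self ht))) (fun _ _ => Set.mem_univ _)
    (fun t ht => (hy t ht).continuousWithinAt)
    (fun t ht => hIci ht (hy t (Set.Ico_subset_Icc_self ht))) (fun _ _ => Set.mem_univ _) h0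
  -- The source cancels in differences, so it needs no regularity and the Lipschitz constant is
  -- `‖A‖`.
  refine LipschitzWith.lipschitzOnWith (LipschitzWith.of_dist_le_mul fun z z' => ?_)
  rw [dist_add_right]
  exact A.lipschitz.dist_le_mul z z'

variable {ι : Type*}

/-- The operator `A` preserves the cone of all `x` with `0 ≤ Λ i x` for every `i`. -/
def PreservesCone (Λ : ι → E →L[ℝ] ℝ) (A : E →L[ℝ] E) : Prop :=
  ∀ x : E, (∀ i, 0 ≤ Λ i x) → ∀ i, 0 ≤ Λ i (A x)

variable {Λ : ι → E →L[ℝ] ℝ} {A : E →L[ℝ] E}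

theorem PreservesCone.pow (hA : PreservesCone Λ A) (n : ℕ) : PreservesCone Λ (A ^ n) := by
  induction n with
  | zero => exact fun f hf u => hf u
  | succ n ih =>
    intro f hf u
    rw [pow_succ]
    exact ih _ (hA f hf) u

variable [CompleteSpace E]

theorem exp_add_of_commute_clm {A B : E →L[ℝ] E} (h : Commute A B) :
    NormedSpace.exp (A + B) = NormedSpace.exp A * NormedSpace.exp B :=
  letI : NormedAlgebra ℚ (E →L[ℝ] E) := NormedAlgebra.restrictScalars ℚ ℝ _
  NormedSpace.exp_add_of_commute h

theorem hasDerivAt_exp_smul_clm (Q : E →L[ℝ] E) (t : ℝ) :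
    HasDerivAt (fun u : ℝ => NormedSpace.exp (u • Q)) (Q * NormedSpace.exp (t • Q)) t :=
  hasDerivAt_exp_smul_const' Q t

theorem exp_smul_exp_neg_smul_apply (Q : E →L[ℝ] E) (t : ℝ) (x : E) :
    NormedSpace.exp (t • Q) (NormedSpace.exp (-t • Q) x) = x := by
  have h : NormedSpace.exp (t • Q) * NormedSpace.exp (-t • Q) = 1 := by
    rw [← exp_add_of_commute_clm (((Commute.refl Q).smul_left t).smul_right (-t)),
      ← add_smul, add_neg_cancel, zero_smul, NormedSpace.exp_zero]
  exact congrArg (fun A : E →L[ℝ] E => A x) h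

/-- An inhomogeneous linear equation with bounded generator and continuous source has a global
solution, given by the variation of constants formula. -/
theorem exists_hasDerivAt_linear_ode (Q : E →L[ℝ] E) {L : ℝ → E} (hL : Continuous L) (x₀ : E) :
    ∃ g : ℝ → E, g 0 = x₀ ∧ ∀ t, HasDerivAt g (Q (g t) + L t) t := by
  have hexp : Continuous fun s : ℝ => NormedSpace.exp (-s • Q) :=
    (continuous_iff_continuousAt.2 fun t => (hasDerivAt_exp_smul_clm Q t).continuousAt).comp
      continuous_neg
  have hc : Continuous fun s : ℝ => NormedSpace.exp (-s • Q) (L s) := hexp.clm_apply hL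
  refine ⟨fun t => NormedSpace.exp (t • Q)
    (x₀ + ∫ s in (0 : ℝ)..t, NormedSpace.exp (-s • Q) (L s)), by simp, fun t => ?_⟩
  have h := (hasDerivAt_exp_smul_clm Q t).clm_apply
    ((hc.integral_hasStrictDerivAt 0 t).hasDerivAt.const_add x₀)
  -- The derivative of the integral contributes exp(tQ) exp(-tQ) L(t), which collapses to L(t).
  rw [exp_smul_exp_neg_smul_apply] at h
  exact h

/-- Each continuous functional `Λ i` can be applied to the exponential series termwise, and every
term is then non-negative. -/
theorem PreservesCone.exp (hA : PreservesCone Λ A) : PreservesCone Λ (NormedSpace.exp A) := by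
  intro x hx i
  have h := NormedSpace.exp_series_hasSum_exp' (𝕂 := ℝ) A
  have h' := (h.mapL (ContinuousLinearMap.apply ℝ E x)).mapL (Λ i)
  refine h'.nonneg fun n => ?_
  have := hA.pow n x hx i
  simp only [ContinuousLinearMap.apply_apply, map_smul, smul_eq_mul]
  positivity

/-- An operator generates a cone preserving semigroup as soon as one of its shifts by a multiple
of the identity preserves the cone. -/
theorem preservesCone_exp_of_shift {M : ℝ} (hA : PreservesCone Λ (A + M • 1)) {t : ℝ}
    (ht : 0 ≤ t) : PreservesCone Λ (NormedSpace.exp (t • A)) := by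
  -- exp(tA) = e^{-tM} exp(t(A + M)): a positive scalar times a cone preserving operator.
  have hcomm : Commute (t • (A + M • 1)) ((-(t * M)) • (1 : E →L[ℝ] E)) :=
    (Commute.one_right _).smul_right _
  have hsplit : t • A = t • (A + M • 1) + (-(t * M)) • (1 : E →L[ℝ] E) := by
    module
  have hscalar : NormedSpace.exp ((-(t * M)) • (1 : E →L[ℝ] E)) =
      Real.exp (-(t * M)) • (1 : E →L[ℝ] E) := by
    rw [← Algebra.algebraMap_eq_smul_one, ← NormedSpace.algebraMap_exp_comm,
      Algebra.algebraMap_eq_smul_one, Real.exp_eq_exp_ℝ]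
  intro x hx i
  rw [hsplit, exp_add_of_commute_clm hcomm, hscalar]
  refine PreservesCone.exp (fun x hx i => ?_) _ (fun j => ?_) i
  · rw [smul_apply, map_smul]
    exact mul_nonneg ht (hA x hx i)
  · change 0 ≤ Λ j (Real.exp (-(t * M)) • x)
    rw [map_smul]
    exact mul_nonneg (Real.exp_pos _).le (hx j)

/-- Comparison principle: a solution of `w' = A w + h` that starts in the cone, with source `h` in
the cone, stays in the cone if some shift of `A` preserves the cone. -/
theorem mem_cone_of_hasDerivWithinAt {M : ℝ} (hA : PreservesCone Λ (A + M • 1)) {T : ℝ}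
    {w h : ℝ → E}
    (hw : ∀ t ∈ Set.Icc 0 T, HasDerivWithinAt w (A (w t) + h t) (Set.Icc 0 T) t)
    (hw0 : ∀ i, 0 ≤ Λ i (w 0)) (hh : ∀ t ∈ Set.Icc 0 T, ∀ i, 0 ≤ Λ i (h t)) {t : ℝ}
    (ht : t ∈ Set.Icc 0 T) (i : ι) : 0 ≤ Λ i (w t) := by
  -- Duhamel interpolation: y runs from the free evolution of `w 0` to `Λ i (w t)`. The two terms
  -- containing A cancel in its derivative, leaving only the propagated source, so y is monotone.
  let y : ℝ → ℝ := fun s => Λ i (NormedSpace.exp ((t - s) • A) (w s))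
  have hsub : Set.Icc 0 t ⊆ Set.Icc 0 T := Set.Icc_subset_Icc_right ht.2
  have hy : ∀ s ∈ Set.Icc 0 t,
      HasDerivWithinAt y (Λ i (NormedSpace.exp ((t - s) • A) (h s))) (Set.Icc 0 t) s := by
    intro s hs
    have h1 : HasDerivAt (fun s : ℝ => NormedSpace.exp ((t - s) • A))
        (-(NormedSpace.exp ((t - s) • A) * A)) s := by
      have := HasDerivAt.scomp (h := fun s : ℝ => t - s) s
        (hasDerivAt_exp_smul_const (𝕂 := ℝ) A (t - s)) ((hasDerivAt_id s).const_sub t)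
      simpa [Function.comp_def] using this
    have h2 := h1.hasDerivWithinAt.clm_apply ((hw s (hsub hs)).mono hsub)
    have h3 := (Λ i).hasFDerivAt.comp_hasDerivWithinAt s h2
    rwa [neg_apply, mul_apply_eq_comp, map_add (NormedSpace.exp ((t - s) • A)),
      neg_add_cancel_left] at h3
  have hmono : MonotoneOn y (Set.Icc 0 t) := by
    refine monotoneOn_of_hasDerivWithinAt_nonneg (convex_Icc 0 t)
      (fun s hs => (hy s hs).continuousWithinAt)
      (fun s hs => (hy s (interior_subset hs)).mono interior_subset) fun s hs => ?_
    have hs' := interior_subset hs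
    exact preservesCone_exp_of_shift hA (sub_nonneg.2 hs'.2) _ (hh s (hsub hs')) i
  have h0 : 0 ≤ y 0 := preservesCone_exp_of_shift hA (by simpa using ht.1) _ hw0 i
  have hle := hmono (Set.left_mem_Icc.2 ht.1) (Set.right_mem_Icc.2 ht.1) ht.1
  have hyt : y t = Λ i (w t) := by simp [y]
  exact hyt ▸ h0.trans hle

end LinearODE

/-! ### Kernel calculus and the passage from functionals to densities. -/

namespace UrnSystem

/-- The function `(u,v) ↦ f(u)`. -/
def fstPull (f : C(I, ℝ)) : C(I × I, ℝ) := f.comp ⟨Prod.fst, continuous_fst⟩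

/-- The function `(u,v) ↦ f(v)`. -/
def sndPull (f : C(I, ℝ)) : C(I × I, ℝ) := f.comp ⟨Prod.snd, continuous_snd⟩

@[simp] theorem fstPull_apply (f : C(I, ℝ)) (p : I × I) : fstPull f p = f p.1 := rfl

@[simp] theorem sndPull_apply (f : C(I, ℝ)) (p : I × I) : sndPull f p = f p.2 := rfl

/-- Integration over `[0,1]`. -/
noncomputable def integ : C(I, ℝ) →L[ℝ] ℝ := densityFunctional 1

@[simp] theorem integ_apply (f : C(I, ℝ)) : integ f = ∫ u : I, f u := by simp [integ]

theorem densityFunctional_eq_integ (g f : C(I, ℝ)) : densityFunctional g f = integ (g * f) := by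
  simp

theorem integ_nonneg {f : C(I, ℝ)} (hf : ∀ u, 0 ≤ f u) : 0 ≤ integ f := by
  rw [integ_apply]
  exact integral_nonneg hf

theorem rowIntegral_nonneg {q : C(I × I, ℝ)} (hq : ∀ p, 0 ≤ q p) (u : I) :
    0 ≤ rowIntegral q u := by
  rw [rowIntegral_apply]
  exact integral_nonneg fun v => hq (u, v)

theorem rowIntegral_add (q q' : C(I × I, ℝ)) :
    rowIntegral (q + q') = rowIntegral q + rowIntegral q' := by
  ext u
  simp only [rowIntegral_apply, ContinuousMap.add_apply]
  exact integral_add (integrable_of_continuous (by fun_prop))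
    (integrable_of_continuous (by fun_prop))

theorem rowIntegral_smul (r : ℝ) (q : C(I × I, ℝ)) :
    rowIntegral (r • q) = r • rowIntegral q := by
  ext u
  simp only [rowIntegral_apply, ContinuousMap.smul_apply, smul_eq_mul, integral_const_mul]

theorem rowIntegral_neg (q : C(I × I, ℝ)) : rowIntegral (-q) = -rowIntegral q := by
  ext u
  simp only [rowIntegral_apply, ContinuousMap.neg_apply, integral_neg]

theorem rowIntegral_sub (q q' : C(I × I, ℝ)) :
    rowIntegral (q - q') = rowIntegral q - rowIntegral q' := by
  rw [sub_eq_add_neg, rowIntegral_add, rowIntegral_neg, sub_eq_add_neg]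

theorem rowIntegral_mul_fstPull (q : C(I × I, ℝ)) (f : C(I, ℝ)) :
    rowIntegral (q * fstPull f) = rowIntegral q * f := by
  ext u
  simp only [rowIntegral_apply, ContinuousMap.mul_apply, fstPull_apply, integral_mul_const]

theorem kernelOp_eq_rowIntegral (k : C(I × I, ℝ)) (f : C(I, ℝ)) :
    kernelOp k f = rowIntegral (k * sndPull f) := by
  ext u
  simp

theorem integ_rowIntegral_transpose (q : C(I × I, ℝ)) :
    integ (rowIntegral (transpose q)) = integ (rowIntegral q) := by
  simp only [integ_apply, rowIntegral_apply, transpose_apply]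
  refine integral_integral_swap (f := fun u v => q (v, u)) ?_
  have hc : Continuous (Function.uncurry fun u v : I => q (v, u)) := by
    simp only [Function.uncurry_def]
    fun_prop
  exact integrableOn_univ.mp (hc.continuousOn.integrableOn_compact isCompact_univ)

theorem transpose_transpose (q : C(I × I, ℝ)) : transpose (transpose q) = q := rfl

theorem transpose_mul (q q' : C(I × I, ℝ)) :
    transpose (q * q') = transpose q * transpose q' := rfl

theorem transpose_fstPull (f : C(I, ℝ)) : transpose (fstPull f) = sndPull f := rfl

theorem transpose_sndPull (f : C(I, ℝ)) : transpose (sndPull f) = fstPull f := rfl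

/-- The integral operators with transposed kernels are adjoint to each other. -/
theorem densityFunctional_kernelOp (k : C(I × I, ℝ)) (g f : C(I, ℝ)) :
    densityFunctional (kernelOp k g) f = densityFunctional g (kernelOp (transpose k) f) := by
  rw [densityFunctional_eq_integ, densityFunctional_eq_integ, kernelOp_eq_rowIntegral,
    kernelOp_eq_rowIntegral, ← rowIntegral_mul_fstPull, mul_comm g, ← rowIntegral_mul_fstPull,
    ← integ_rowIntegral_transpose]
  congr 2
  simp only [transpose_mul, transpose_fstPull, transpose_sndPull]
  ring

theorem densityFunctional_mulOp (m g f : C(I, ℝ)) :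
    densityFunctional (mulOp m g) f = densityFunctional g (mulOp m f) := by
  rw [densityFunctional_eq_integ, densityFunctional_eq_integ]
  congr 1
  change m * g * f = g * (m * f)
  ring

/-- The embedding `g ↦ g(u) du` of `C[0,1]` into its dual. -/
noncomputable def densityCLM : C(I, ℝ) →L[ℝ] StrongDual ℝ C(I, ℝ) :=
  LinearMap.mkContinuous
    { toFun := densityFunctional
      map_add' := fun g g' => by
        ext f
        rw [add_apply]
        simp only [densityFunctional_eq_integ, add_mul, map_add]
      map_smul' := fun r g => by
        ext f
        rw [smul_apply]
        simp only [densityFunctional_eq_integ, smul_mul_assoc, map_smul, RingHom.id_apply] }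
    1 (fun g => by
      rw [one_mul]
      change ‖densityFunctional g‖ ≤ ‖g‖
      unfold densityFunctional
      apply LinearMap.mkContinuous_norm_le
      positivity)

@[simp] theorem densityCLM_apply (g : C(I, ℝ)) : densityCLM g = densityFunctional g := rfl

/-- Lebesgue measure on `[0,1]` charges every non-empty open set. -/
theorem isOpenPosMeasure_volume : (volume : Measure I).IsOpenPosMeasure := by
  refine ⟨fun U hU ⟨x, hx⟩ h0 => ?_⟩
  obtain ⟨V, hV, rfl⟩ := isOpen_induced_iff.1 hU
  -- The point x may be an endpoint; being in the closure of (0,1), it still forces V to meet (0,1)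
  -- in a non-empty open set.
  have hcl : (x : ℝ) ∈ closure (Set.Ioo (0 : ℝ) 1) := by
    rw [closure_Ioo zero_ne_one]
    exact x.2
  obtain ⟨y, hyV, hy⟩ := mem_closure_iff.1 hcl V hV hx
  have hpos : 0 < volume (V ∩ Set.Ioo (0 : ℝ) 1) :=
    (hV.inter isOpen_Ioo).measure_pos volume ⟨y, hyV, hy⟩
  rw [unitInterval.volume_apply, Subtype.image_preimage_coe] at h0
  refine hpos.ne' (measure_mono_null ?_ h0)
  exact fun z hz => ⟨Set.Ioo_subset_Icc_self hz.2, hz.1⟩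

/-- Testing on g - g' itself gives ∫(g - g')² = 0, and a continuous function vanishing almost
everywhere vanishes identically. -/
theorem densityFunctional_injective : Function.Injective densityFunctional := by
  intro g g' h
  have h1 : ∫ u : I, (g - g') u * (g - g') u = 0 := by
    have h2 : densityFunctional (g - g') (g - g') = 0 := by
      have h3 : densityFunctional (g - g') = 0 := by
        rw [← densityCLM_apply, map_sub, densityCLM_apply, densityCLM_apply, h, sub_self]
      rw [h3, zero_apply]
    simpa using h2
  have hc : Continuous fun u : I => (g - g') u * (g - g') u := by fun_prop
  have := isOpenPosMeasure_volume
  have h3 := (hc.ae_eq_iff_eq volume continuous_zero).1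
    ((integral_eq_zero_iff_of_nonneg (fun u => mul_self_nonneg _)
      (integrable_of_continuous hc)).1 h1)
  ext u
  have h4 := congrFun h3 u
  simpa [sub_eq_zero] using h4

variable (S : UrnSystem)

/-- The predual of `P₂`, acting on densities. -/
noncomputable def predualP2 : C(I, ℝ) →L[ℝ] C(I, ℝ) :=
  mulOp ((S.c ^ 2 - 1) * S.b + rowIntegral (S.lam * (S.a1 ^ 2 - 1))
      + rowIntegral (transpose (S.lam * (S.a4 ^ 2 - 1))))
    + (kernelOp (S.lam * S.a2 ^ 2) + kernelOp (transpose (S.lam * S.a3 ^ 2)))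

/-- The density of the source functional `l₁`. -/
noncomputable def sourceDensity (r : C(I, ℝ)) : C(I, ℝ) :=
  (2 : ℝ) • (r * kernelOp (S.lam * S.a1 * S.a2) r)
    + (2 : ℝ) • (r * kernelOp (transpose (S.lam * S.a3 * S.a4)) r)

theorem l1_eq_densityCLM (r : C(I, ℝ)) : S.l1 r = densityCLM (S.sourceDensity r) := by
  simp only [l1, sourceDensity, map_add, map_smul, densityCLM_apply]

/-- P₂* maps densities to densities: multiplications are self-adjoint, and the kernels of P₅ and P₆
are transposed. This reduces the dual equation to one in C[0,1]. -/
theorem densityFunctional_comp_P2 (g : C(I, ℝ)) :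
    (densityFunctional g).comp S.P2 = densityFunctional (S.predualP2 g) := by
  ext f
  rw [ContinuousLinearMap.comp_apply]
  have hm : ∀ m m' : C(I, ℝ), mulOp (m + m') g = mulOp m g + mulOp m' g := fun m m' =>
    add_mul m m' g
  simp only [predualP2, P2, P3, P4, P5, P6, P7, add_apply, hm, map_add, ← densityCLM_apply]
  simp only [densityCLM_apply, densityFunctional_mulOp, densityFunctional_kernelOp,
    transpose_transpose]
  ring

end UrnSystem

theorem ContinuousLinearMap.hasDerivWithinAt_comp {E F : Type*} [NormedAddCommGroup E]
    [NormedSpace ℝ E] [NormedAddCommGroup F] [NormedSpace ℝ F] (A : E →L[ℝ] F) {g : ℝ → E} {g' : E}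
    {s : Set ℝ} {t : ℝ} (h : HasDerivWithinAt g g' s t) :
    HasDerivWithinAt (fun t => A (g t)) (A g') s t :=
  A.hasFDerivAt.comp_hasDerivWithinAt t h

/-! ### Comparison: the second moment density dominates the square of the first. -/

namespace UrnSystem

/-- The evaluation functionals, whose common cone consists of the non-negative functions. -/
noncomputable def evalAt (u : I) : C(I, ℝ) →L[ℝ] ℝ := ContinuousMap.evalCLM ℝ u

@[simp] theorem evalAt_apply (u : I) (f : C(I, ℝ)) : evalAt u f = f u := rfl

theorem preservesCone_kernelOp {k : C(I × I, ℝ)} (hk : ∀ p, 0 ≤ k p) :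
    PreservesCone evalAt (kernelOp k) := fun f hf u => by
  rw [evalAt_apply, kernelOp_apply]
  exact integral_nonneg fun v => mul_nonneg (hk _) (hf v)

theorem PreservesCone.add {A B : C(I, ℝ) →L[ℝ] C(I, ℝ)} (hA : PreservesCone evalAt A)
    (hB : PreservesCone evalAt B) : PreservesCone evalAt (A + B) := fun f hf u => by
  rw [add_apply, map_add]
  exact add_nonneg (hA f hf u) (hB f hf u)

/-- The multiplier m may be negative, but m + ‖m‖ is not; the remaining part is already positive. -/
theorem preservesCone_mulOp_add_shift (m : C(I, ℝ)) {B : C(I, ℝ) →L[ℝ] C(I, ℝ)}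
    (hB : PreservesCone evalAt B) : PreservesCone evalAt (mulOp m + B + ‖m‖ • 1) := by
  intro f hf u
  have hm : 0 ≤ m u + ‖m‖ := by
    have := (abs_le.1 (m.norm_coe_le_norm u)).1
    linarith
  have h : evalAt u ((mulOp m + B + ‖m‖ • (1 : C(I, ℝ) →L[ℝ] C(I, ℝ))) f) =
      (m u + ‖m‖) * f u + B f u := by
    change m u * f u + B f u + ‖m‖ * f u = _
    ring
  rw [h]
  exact add_nonneg (mul_nonneg hm (hf u)) (hB f hf u)

variable {S : UrnSystem}

theorem Admissible.preservesCone_predualP2 (hS : S.Admissible) :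
    ∃ M : ℝ, PreservesCone evalAt (S.predualP2 + M • 1) := by
  refine ⟨_, preservesCone_mulOp_add_shift _ (PreservesCone.add (preservesCone_kernelOp fun p => ?_)
    (preservesCone_kernelOp fun p => ?_))⟩
  · exact mul_nonneg (hS.lam_nonneg p) (sq_nonneg (S.a2 p))
  · exact mul_nonneg (hS.lam_nonneg p.swap) (sq_nonneg (S.a3 p.swap))

theorem rowIntegral_mul (q : C(I × I, ℝ)) (f : C(I, ℝ)) :
    rowIntegral q * f = rowIntegral (q * fstPull f) := (rowIntegral_mul_fstPull q f).symm

variable (S)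

/-- The defect of the square of the hydrodynamic density in the second moment equation is a sum
of squares. -/
theorem defect_eq (r : C(I, ℝ)) :
    S.predualP2 (r * r) + S.sourceDensity r - (S.hydroOp r * r + r * S.hydroOp r) =
      S.b * (S.c - 1) ^ 2 * r ^ 2
        + rowIntegral (S.lam * ((S.a1 - 1) * fstPull r + S.a2 * sndPull r) ^ 2)
        + rowIntegral (transpose
            (S.lam * ((S.a4 - 1) * sndPull r + S.a3 * fstPull r) ^ 2)) := by
  have hm : ∀ m f : C(I, ℝ), mulOp m f = m * f := fun _ _ => rfl
  have hL : ∀ f g : C(I, ℝ), fstPull (f * g) = fstPull f * fstPull g := fun _ _ => rfl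
  have hR : ∀ f g : C(I, ℝ), sndPull (f * g) = sndPull f * sndPull g := fun _ _ => rfl
  have htm : ∀ p q : C(I × I, ℝ), transpose (p * q) = transpose p * transpose q :=
    fun _ _ => rfl
  have hta : ∀ p q : C(I × I, ℝ), transpose (p + q) = transpose p + transpose q :=
    fun _ _ => rfl
  have hts : ∀ p q : C(I × I, ℝ), transpose (p - q) = transpose p - transpose q :=
    fun _ _ => rfl
  have ht1 : transpose 1 = 1 := rfl
  simp only [predualP2, sourceDensity, hydroOp, add_apply, hm, kernelOp_eq_rowIntegral, two_smul,
    mul_comm r, add_mul, rowIntegral_mul, hL, hR]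
  simp only [pow_two, htm, hta, hts, ht1, transpose_fstPull, transpose_sndPull]
  -- Once transposed, the second square has the shape of the first with (λ, a₁, a₂) replaced by the
  -- transposes of (λ, a₄, a₃), so `hrow` serves both.
  generalize transpose S.lam = lam'
  generalize transpose S.a3 = a3'
  generalize transpose S.a4 = a4'
  -- With x = r(u), y = r(v): ((a-1)x + dy)² = (a²-1)x² + d²y² + 2adxy - 2(a-1)x² - 2dxy. The first
  -- three terms come from P and the source, the last two from the derivative of r².
  have hrow : ∀ l a d : C(I × I, ℝ),
      rowIntegral (l * (((a - 1) * fstPull r + d * sndPull r) *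
          ((a - 1) * fstPull r + d * sndPull r))) =
        rowIntegral (l * (a * a - 1) * (fstPull r * fstPull r))
          + rowIntegral (l * (d * d) * (sndPull r * sndPull r))
          + (rowIntegral (l * a * d * sndPull r * fstPull r)
            + rowIntegral (l * a * d * sndPull r * fstPull r))
          - (rowIntegral (l * (a - 1) * fstPull r * fstPull r)
            + rowIntegral (l * (a - 1) * fstPull r * fstPull r))
          - (rowIntegral (l * d * sndPull r * fstPull r)
            + rowIntegral (l * d * sndPull r * fstPull r)) := by
    intro l a d
    simp only [← rowIntegral_add, ← rowIntegral_sub]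
    congr 1
    ring
  rw [hrow, hrow, mul_right_comm lam' a4' a3']
  ring

variable {S}

theorem Admissible.defect_nonneg (hS : S.Admissible) (r : C(I, ℝ)) (u : I) :
    0 ≤ (S.predualP2 (r * r) + S.sourceDensity r
      - (S.hydroOp r * r + r * S.hydroOp r)) u := by
  rw [defect_eq]
  refine add_nonneg (add_nonneg ?_ (rowIntegral_nonneg (fun p => ?_) u))
    (rowIntegral_nonneg (fun p => ?_) u)
  · exact mul_nonneg (mul_nonneg (hS.b_nonneg u) (sq_nonneg (S.c u - 1))) (sq_nonneg (r u))
  · exact mul_nonneg (hS.lam_nonneg p) (sq_nonneg _)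
  · exact mul_nonneg (hS.lam_nonneg p.swap) (sq_nonneg _)

/-- The second moment density dominates the square of the first moment density. -/
theorem Admissible.sq_le_secondMoment (hS : S.Admissible) {T : ℝ} {ρ g : ℝ → C(I, ℝ)}
    (hρ : S.IsHydrodynamicDensity ρ) (hg0 : g 0 = S.phi)
    (hg : ∀ t ∈ Set.Icc 0 T, HasDerivAt g (S.predualP2 (g t) + S.sourceDensity (ρ t)) t)
    {t : ℝ} (ht : t ∈ Set.Icc 0 T) (u : I) : ρ t u ^ 2 ≤ g t u := by
  obtain ⟨M, hM⟩ := hS.preservesCone_predualP2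
  -- Adding and subtracting P(ρ²) turns the derivative of g - ρ² into P(g - ρ²) plus the defect.
  have h := mem_cone_of_hasDerivWithinAt hM (T := T) (w := fun t => g t - ρ t * ρ t)
    (h := fun t => S.predualP2 (ρ t * ρ t) + S.sourceDensity (ρ t)
      - (S.hydroOp (ρ t) * ρ t + ρ t * S.hydroOp (ρ t))) (fun t ht => ?_) (fun u => ?_)
    (fun t _ u => hS.defect_nonneg (ρ t) u) ht u
  · simp only [evalAt_apply, ContinuousMap.sub_apply, ContinuousMap.mul_apply] at h
    linarith
  · have h1 := (hρ.2 t ht.1).mono (Set.Icc_subset_Ici_self : Set.Icc 0 T ⊆ Set.Ici 0)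
    refine ((hg t ht).hasDerivWithinAt.sub (h1.mul h1)).congr_deriv ?_
    rw [map_sub]
    abel
  · have h1 := hS.phi_mem u
    simp only [evalAt_apply, ContinuousMap.sub_apply, ContinuousMap.mul_apply, hg0, hρ.1]
    -- φ - φ² ≥ 0 since 0 ≤ φ ≤ 1.
    nlinarith

/-! ### Existence of solutions and identification of ϑ. -/

variable (S)

theorem exists_hydrodynamicDensity : ∃ ρ, S.IsHydrodynamicDensity ρ := by
  obtain ⟨ρ, h0, hρ⟩ := exists_hasDerivAt_linear_ode S.hydroOp
    (continuous_const (y := (0 : C(I, ℝ)))) S.phi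
  refine ⟨ρ, h0, fun t _ => ?_⟩
  have h := (hρ t).hasDerivWithinAt (s := Set.Ici 0)
  rwa [add_zero] at h

theorem continuous_sourceDensity : Continuous S.sourceDensity := by
  unfold sourceDensity
  fun_prop

theorem exists_secondMomentDensity {ρ : ℝ → C(I, ℝ)} (hρ : S.IsHydrodynamicDensity ρ) :
    ∃ g : ℝ → C(I, ℝ), g 0 = S.phi ∧ Continuous g ∧
      ∀ t, 0 ≤ t → HasDerivAt g (S.predualP2 (g t) + S.sourceDensity (ρ t)) t := by
  -- ρ is controlled only for t ≥ 0; freezing it at ρ(0) for negative times makes the source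
  -- continuous on the whole line.
  have hc : Continuous fun t : ℝ => ρ (max t 0) := by
    have h : ContinuousOn ρ (Set.Ici 0) := fun t ht => (hρ.2 t ht).continuousWithinAt
    exact h.comp_continuous (by fun_prop) fun t => le_max_right t 0
  obtain ⟨g, h0, hg⟩ := exists_hasDerivAt_linear_ode S.predualP2
    (S.continuous_sourceDensity.comp hc) S.phi
  refine ⟨g, h0, continuous_iff_continuousAt.2 fun t => (hg t).continuousAt, fun t ht => ?_⟩
  have h := hg t
  simpa only [Function.comp_apply, max_eq_left ht] using h

variable {S}

theorem isSecondMomentSolution_densityFunctional {T : ℝ} {ρ g : ℝ → C(I, ℝ)}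
    (hg0 : g 0 = S.phi)
    (hg : ∀ t, 0 ≤ t → HasDerivAt g (S.predualP2 (g t) + S.sourceDensity (ρ t)) t) :
    S.IsSecondMomentSolution T ρ fun t => densityFunctional (g t) := by
  refine ⟨by simp only [hg0], fun t ht => ?_⟩
  have h := ContinuousLinearMap.hasDerivWithinAt_comp (F := StrongDual ℝ C(I, ℝ)) densityCLM
    ((hg t ht.1).hasDerivWithinAt (s := Set.Icc 0 T))
  refine h.congr_deriv ?_
  rw [map_add, densityCLM_apply, densityFunctional_comp_P2, l1_eq_densityCLM]

/-- The second moment equation has at most one solution. -/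
theorem IsSecondMomentSolution.eqOn {T : ℝ} {ρ : ℝ → C(I, ℝ)} {θ θ' : ℝ → StrongDual ℝ C(I, ℝ)}
    (h : S.IsSecondMomentSolution T ρ θ) (h' : S.IsSecondMomentSolution T ρ θ') :
    Set.EqOn θ θ' (Set.Icc 0 T) :=
  eqOn_of_hasDerivWithinAt_linear ((ContinuousLinearMap.compL ℝ C(I, ℝ) C(I, ℝ) ℝ).flip S.P2)
    (L := fun t => S.l1 (ρ t)) h.2 h'.2 (h.1.trans h'.1.symm)

theorem exists_isDensityOf (T : ℝ) {g : ℝ → C(I, ℝ)} (hg : Continuous g) :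
    ∃ ϑ : C(Set.Icc (0 : ℝ) T × I, ℝ), IsDensityOf ϑ fun t => densityFunctional (g t) :=
  ⟨⟨fun p => g p.1 p.2, by fun_prop⟩, fun _ _ => rfl⟩

/-- The time slice `ϑ(s, ·)`. -/
def slice {T : ℝ} (ϑ : C(Set.Icc (0 : ℝ) T × I, ℝ)) (s : Set.Icc (0 : ℝ) T) : C(I, ℝ) :=
  ⟨fun u => ϑ (s, u), by fun_prop⟩

@[simp] theorem slice_apply {T : ℝ} (ϑ : C(Set.Icc (0 : ℝ) T × I, ℝ)) (s : Set.Icc (0 : ℝ) T)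
    (u : I) : slice ϑ s u = ϑ (s, u) := rfl

/-- The comparison is known for the solution g built in C[0,1]; uniqueness of θ and injectivity of
the embedding carry it to an arbitrary ϑ. -/
theorem Admissible.sq_le_density (hS : S.Admissible) {T : ℝ} {ρ : ℝ → C(I, ℝ)}
    {θ : ℝ → StrongDual ℝ C(I, ℝ)} {ϑ : C(Set.Icc (0 : ℝ) T × I, ℝ)}
    (hρ : S.IsHydrodynamicDensity ρ) (hθ : S.IsSecondMomentSolution T ρ θ)
    (hϑ : IsDensityOf ϑ θ) (s : Set.Icc (0 : ℝ) T) (u : I) : ρ s u ^ 2 ≤ ϑ (s, u) := by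
  obtain ⟨g, hg0, -, hg⟩ := S.exists_secondMomentDensity hρ
  have h1 : θ s = densityFunctional (g s) :=
    hθ.eqOn (isSecondMomentSolution_densityFunctional hg0 hg) s.2
  have h2 : slice ϑ s = g s := by
    refine densityFunctional_injective ?_
    rw [← h1]
    ext f
    exact (hϑ s f).symm
  rw [← slice_apply, h2]
  exact hS.sq_le_secondMoment hρ hg0 (fun t ht => hg t ht.1) s.2 u

end UrnSystem

/-! ### The form: bilinearity and representation by squares. -/

namespace UrnSystem

variable (S : UrnSystem)

/-- The noise kernel coming from the receiving end of an interaction, for the second moment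
density `w` and the first moment density `r`. -/
noncomputable def fstNoise (w r : C(I, ℝ)) : C(I × I, ℝ) :=
  S.lam * (S.a1 - 1) ^ 2 * fstPull w + S.lam * S.a2 ^ 2 * sndPull w
    + (2 : ℝ) • (S.lam * (S.a1 - 1) * S.a2 * sndPull r * fstPull r)

/-- The noise kernel coming from the other end of an interaction. -/
noncomputable def sndNoise (w r : C(I, ℝ)) : C(I × I, ℝ) :=
  S.lam * S.a3 ^ 2 * fstPull w + S.lam * (S.a4 - 1) ^ 2 * sndPull w
    + (2 : ℝ) • (S.lam * S.a3 * (S.a4 - 1) * fstPull r * sndPull r)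

/-- The function `K₁`, as an element of `C[0,1]`. -/
noncomputable def diagNoise (w r : C(I, ℝ)) : C(I, ℝ) :=
  w * S.b * (S.c - 1) ^ 2 + rowIntegral (S.fstNoise w r)
    + rowIntegral (transpose (S.sndNoise w r))

/-- The function `K₂`, as an element of `C([0,1]²)`. -/
noncomputable def crossNoise (w r : C(I, ℝ)) : C(I × I, ℝ) :=
  (2 : ℝ) • (S.lam * (S.a1 - 1) * S.a3 * fstPull w + S.lam * S.a2 * (S.a4 - 1) * sndPull w
    + S.lam * (S.a1 - 1) * (S.a4 - 1) * fstPull r * sndPull r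
    + S.lam * S.a2 * S.a3 * fstPull r * sndPull r)

/-- The quadratic form written with continuous kernels. -/
noncomputable def noiseForm (k : C(I, ℝ)) (q : C(I × I, ℝ)) (f : C(I, ℝ)) : ℝ :=
  integ (k * f * f) + integ (kernelOp q f * f)

section

variable {T : ℝ} (ρ : ℝ → C(I, ℝ)) (ϑ : C(Set.Icc (0 : ℝ) T × I, ℝ)) (s : Set.Icc (0 : ℝ) T)

theorem K1_eq_diagNoise (u : I) : S.K1 ρ ϑ s u = S.diagNoise (slice ϑ s) (ρ s) u := by
  have ht : transpose (S.sndNoise (slice ϑ s) (ρ s)) =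
      transpose (S.lam * S.a3 ^ 2) * sndPull (slice ϑ s)
        + transpose (S.lam * (S.a4 - 1) ^ 2) * fstPull (slice ϑ s)
        + (2 : ℝ) • (transpose (S.lam * S.a3 * (S.a4 - 1)) * sndPull (ρ s) * fstPull (ρ s)) := rfl
  rw [diagNoise, ht, fstNoise]
  simp only [rowIntegral_add, rowIntegral_smul, rowIntegral_mul_fstPull]
  simp only [K1, ContinuousMap.add_apply, ContinuousMap.mul_apply, ContinuousMap.smul_apply,
    ContinuousMap.sub_apply, ContinuousMap.pow_apply, ContinuousMap.one_apply, smul_eq_mul,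
    rowIntegral_apply, transpose_apply, sndPull_apply, slice_apply]
  have h : ∫ v : I, S.lam (u, v) * S.a2 (u, v) ^ 2 * ϑ (s, v) =
      ∫ v : I, ϑ (s, v) * S.lam (u, v) * S.a2 (u, v) ^ 2 :=
    integral_congr_ae (Filter.Eventually.of_forall fun v => by ring)
  rw [h]
  ring

theorem K2_eq_crossNoise (u v : I) :
    S.K2 ρ ϑ s u v = S.crossNoise (slice ϑ s) (ρ s) (u, v) := by
  simp only [K2, crossNoise, ContinuousMap.add_apply, ContinuousMap.mul_apply,
    ContinuousMap.smul_apply, ContinuousMap.sub_apply, ContinuousMap.one_apply, smul_eq_mul,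
    fstPull_apply, sndPull_apply, slice_apply]
  ring

theorem quadForm_eq_noiseForm (f : C(I, ℝ)) :
    S.quadForm ρ ϑ s f =
      noiseForm (S.diagNoise (slice ϑ s) (ρ s)) (S.crossNoise (slice ϑ s) (ρ s)) f := by
  simp only [quadForm, noiseForm, K1_eq_diagNoise, K2_eq_crossNoise, integ_apply,
    ContinuousMap.mul_apply, kernelOp_apply, ← integral_mul_const]
  congr 1
  · exact integral_congr_ae (Filter.Eventually.of_forall fun u => by ring)
  · refine integral_congr_ae (Filter.Eventually.of_forall fun u => ?_)
    exact integral_congr_ae (Filter.Eventually.of_forall fun v => by ring)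

/-- K₂ need not be symmetric, so polarization produces the symmetrized kernel term; symmetry and
linearity can be read off from this formula. -/
theorem bracket_eq_bilinear (f g : C(I, ℝ)) :
    let k := S.diagNoise (slice ϑ s) (ρ s)
    let q := S.crossNoise (slice ϑ s) (ρ s)
    S.bracket ρ ϑ s f g =
      integ (k * f * g) + (integ (kernelOp q f * g) + integ (kernelOp q g * f)) / 2 := by
  simp only [bracket, quadForm_eq_noiseForm, noiseForm, map_add, map_sub, mul_add, add_mul,
    mul_sub, sub_mul]
  rw [mul_right_comm _ g f]
  ring

theorem bracket_comm (f g : C(I, ℝ)) : S.bracket ρ ϑ s f g = S.bracket ρ ϑ s g f := by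
  simp only [bracket_eq_bilinear]
  rw [mul_right_comm _ g f]
  ring

theorem bracket_add_smul_left (f₁ f₂ g : C(I, ℝ)) (c₁ c₂ : ℝ) :
    S.bracket ρ ϑ s (c₁ • f₁ + c₂ • f₂) g =
      c₁ * S.bracket ρ ϑ s f₁ g + c₂ * S.bracket ρ ϑ s f₂ g := by
  simp only [bracket_eq_bilinear, map_add, map_smul, mul_add, add_mul, mul_smul_comm,
    smul_mul_assoc, smul_eq_mul]
  ring

theorem bracket_self (f : C(I, ℝ)) : S.bracket ρ ϑ s f f = S.quadForm ρ ϑ s f := by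
  simp only [bracket_eq_bilinear, quadForm_eq_noiseForm, noiseForm]
  ring

end

/-- The form is the expected square of the jumps of the tested field. -/
theorem noiseForm_eq (w r f : C(I, ℝ)) :
    noiseForm (S.diagNoise w r) (S.crossNoise w r) f =
      integ (w * S.b * (S.c - 1) ^ 2 * f * f) +
        integ (rowIntegral (S.lam *
          (((S.a1 - 1) * fstPull f + S.a3 * sndPull f) ^ 2 * fstPull w
            + (S.a2 * fstPull f + (S.a4 - 1) * sndPull f) ^ 2 * sndPull w
            + (2 : ℝ) • (((S.a1 - 1) * fstPull f + S.a3 * sndPull f)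
              * (S.a2 * fstPull f + (S.a4 - 1) * sndPull f) * fstPull r * sndPull r)))) := by
  -- Exchanging u and v turns f(u)² into f(v)², so this part joins the other interaction terms under
  -- one double integral, where the claim becomes a pointwise identity.
  have hsnd : integ (rowIntegral (transpose (S.sndNoise w r)) * f * f) =
      integ (rowIntegral (S.sndNoise w r * sndPull f * sndPull f)) := by
    rw [rowIntegral_mul, rowIntegral_mul, ← integ_rowIntegral_transpose]
    rfl
  rw [noiseForm, diagNoise, add_mul, add_mul, add_mul, add_mul, map_add, map_add, hsnd,
    kernelOp_eq_rowIntegral, rowIntegral_mul, rowIntegral_mul, rowIntegral_mul, add_assoc,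
    add_assoc, ← map_add, ← map_add, ← rowIntegral_add, ← rowIntegral_add]
  congr 3
  simp only [fstNoise, sndNoise, crossNoise, two_smul]
  ring

variable {S}

theorem Admissible.noiseForm_nonneg (hS : S.Admissible) {w r : C(I, ℝ)}
    (h : ∀ u, r u ^ 2 ≤ w u) (f : C(I, ℝ)) :
    0 ≤ noiseForm (S.diagNoise w r) (S.crossNoise w r) f := by
  rw [noiseForm_eq]
  refine add_nonneg (integ_nonneg fun u => ?_)
    (integ_nonneg fun u => rowIntegral_nonneg (fun p => ?_) u)
  · have hw : 0 ≤ w u := (sq_nonneg _).trans (h u)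
    have := mul_nonneg (mul_nonneg hw (hS.b_nonneg u)) (sq_nonneg ((S.c u - 1) * f u))
    calc 0 ≤ _ := this
      _ = w u * S.b u * (S.c u - 1) ^ 2 * f u * f u := by ring
  · refine mul_nonneg (hS.lam_nonneg p) ?_
    -- Replacing w by the smaller r² leaves the square (A r(u) + B r(v))².
    have key : ∀ A B : ℝ, 0 ≤ A ^ 2 * w p.1 + B ^ 2 * w p.2 + 2 * (A * B * r p.1 * r p.2) := by
      intro A B
      have h1 := mul_le_mul_of_nonneg_left (h p.1) (sq_nonneg A)
      have h2 := mul_le_mul_of_nonneg_left (h p.2) (sq_nonneg B)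
      linarith [sq_nonneg (A * r p.1 + B * r p.2)]
    exact key ((S.a1 p - 1) * f p.1 + S.a3 p * f p.2) (S.a2 p * f p.1 + (S.a4 p - 1) * f p.2)

end UrnSystem

theorem lemma2p5 (S : UrnSystem) (hS : S.Admissible) (T : ℝ) (hT : 0 < T) :
    -- the objects entering the form exist
    (∃ (ρ : ℝ → C(unitInterval, ℝ)) (θ : ℝ → StrongDual ℝ C(unitInterval, ℝ))
        (ϑ : C(Set.Icc (0 : ℝ) T × unitInterval, ℝ)),
      S.IsHydrodynamicDensity ρ ∧ S.IsSecondMomentSolution T ρ θ ∧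
        UrnSystem.IsDensityOf ϑ θ) ∧
    -- and the form built from them is a non-negative definite symmetric bilinear form
    ∀ (ρ : ℝ → C(unitInterval, ℝ)) (θ : ℝ → StrongDual ℝ C(unitInterval, ℝ))
        (ϑ : C(Set.Icc (0 : ℝ) T × unitInterval, ℝ)),
      S.IsHydrodynamicDensity ρ → S.IsSecondMomentSolution T ρ θ →
      UrnSystem.IsDensityOf ϑ θ →
      ∀ s : Set.Icc (0 : ℝ) T,
        (∀ f : C(unitInterval, ℝ),
          S.bracket ρ ϑ s f f = S.quadForm ρ ϑ s f ∧ 0 ≤ S.bracket ρ ϑ s f f) ∧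
        (∀ f₁ f₂ : C(unitInterval, ℝ), S.bracket ρ ϑ s f₁ f₂ = S.bracket ρ ϑ s f₂ f₁) ∧
        (∀ (f₁ f₂ g : C(unitInterval, ℝ)) (c₁ c₂ : ℝ),
          S.bracket ρ ϑ s (c₁ • f₁ + c₂ • f₂) g =
            c₁ * S.bracket ρ ϑ s f₁ g + c₂ * S.bracket ρ ϑ s f₂ g) := by
  refine ⟨?_, fun ρ θ ϑ hρ hθ hϑ s => ⟨fun f => ⟨S.bracket_self ρ ϑ s f, ?_⟩,
    S.bracket_comm ρ ϑ s, S.bracket_add_smul_left ρ ϑ s⟩⟩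
  · obtain ⟨ρ, hρ⟩ := S.exists_hydrodynamicDensity
    obtain ⟨g, hg0, hgc, hg⟩ := S.exists_secondMomentDensity hρ
    obtain ⟨ϑ, hϑ⟩ := UrnSystem.exists_isDensityOf T hgc
    exact ⟨ρ, _, ϑ, hρ, UrnSystem.isSecondMomentSolution_densityFunctional hg0 hg, hϑ⟩
  · rw [S.bracket_self, S.quadForm_eq_noiseForm]
    exact hS.noiseForm_nonneg (hS.sq_le_density hρ hθ hϑ s) f
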